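/- Let $m,n,d\ge 1$, let $F_u\in\mathbb R^{m\times d}$ and $F_v\in\mathbb R^{n\times d}$ be feature matrices, and let $M\in[0,1]^{m\times n}$ satisfy $\|M\|_*\le t$ (nuclear norm) and $M=F_uF_u^{T}\,M\,F_vF_v^{T}$. Let $\rho\in[0,1)$ and let $A\in\{0,1\}^{m\times n}$ be a random matrix with independent entries such that $$P(A_{ij}=1)=M_{ij}(1-\rho),\qquad P(A_{ij}=0)=1-M_{ij}(1-\rho).$$ Define, for $x\in\mathbb R$ and $a\in\{0,1\}$, $$\tilde\ell(x,1)=\frac{(x-1)^2-\rho x^2}{1-\rho},\qquad \tilde\ell(x,0)=x^2,$$ and let $\hat D$ be an optimal solution of the inductive shifted matrix completion problem $$\min_{D\in\mathbb R^{d\times d}}\ \sum_{i,j}\tilde\ell\big((F_uDF_v^{T})_{ij},A_{ij}\big)\quad\text{such that}\quad \|D\|_*\le t,\quad 0\le (F_uDF_v^{T})_{ij}\le 1\ \text{ for all } i,j.$$ Let $\mathcal X_u$ and $\mathcal X_v$ be the largest Euclidean norms of a row of $F_u$ and of $F_v$, respectively. Then for every $\delta\in(0,1)$, with probability at least $1-\delta$,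 every such optimal solution $\hat D$ satisfies $$\frac1{mn}\sum_{i,j}\big(M_{ij}-(F_u\hat DF_v^{T})_{ij}\big)^2\ \le\ \frac{6\sqrt{\log(2/\delta)}}{\sqrt{mn}\,(1-\rho)}+\frac{4t\sqrt{\log(2d)}}{\sqrt{mn}\,\sqrt{1-\rho}}\,\mathcal X_u\mathcal X_v .$$ -/

import Mathlib

open MeasureTheory ProbabilityTheory Matrix

noncomputable section

/-- The nuclear (trace) norm of a real matrix: the sum of its singular values. -/
def nuclearNorm {m n : ℕ} (X : Matrix (Fin m) (Fin n) ℝ) : ℝ :=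
  ∑ k ∈ Finset.range n, (Matrix.toEuclideanLin X).singularValues k

/-- The largest Euclidean norm of a row of `F`. -/
def maxRowNorm {m d : ℕ} (F : Matrix (Fin m) (Fin d) ℝ) : ℝ :=
  ⨆ i : Fin m, √(∑ k : Fin d, F i k ^ 2)

/-- The unbiased estimator of the squared loss, for noise rate `ρ`, prediction `x` and
observed label `a ∈ {0, 1}`. -/
def shiftLoss (ρ x : ℝ) (a : Fin 2) : ℝ :=
  if a = 1 then ((x - 1) ^ 2 - ρ * x ^ 2) / (1 - ρ) else x ^ 2

/-- The random 0-1 matrix `A` is observed from `M` in the non-deterministic positive-unlabeled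
model with noise rate `ρ`: its entries are independent, `A i j` is `1` with probability
`M i j * (1 - ρ)` and `0` with probability `1 - M i j * (1 - ρ)`. -/
structure IsPUObservation {m n : ℕ} {Ω : Type*} [MeasurableSpace Ω] (P : Measure Ω)
    (M : Matrix (Fin m) (Fin n) ℝ) (ρ : ℝ) (A : Ω → Matrix (Fin m) (Fin n) (Fin 2)) : Prop where
  measurable_entry : ∀ i j, Measurable fun ω => A ω i j
  indep : iIndepFun (fun (p : Fin m × Fin n) ω => A ω p.1 p.2) P
  prob_one : ∀ i j, P {ω | A ω i j = 1} = ENNReal.ofReal (M i j * (1 - ρ))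
  prob_zero : ∀ i j, P {ω | A ω i j = 0} = ENNReal.ofReal (1 - M i j * (1 - ρ))

/-- The feasible set of inductive shifted matrix completion: `‖D‖_* ≤ t` and all the entries of
`Fu * D * Fvᵀ` lie in `[0, 1]`. -/
def inductiveFeasible {m n d : ℕ} (Fu : Matrix (Fin m) (Fin d) ℝ)
    (Fv : Matrix (Fin n) (Fin d) ℝ) (t : ℝ) : Set (Matrix (Fin d) (Fin d) ℝ) :=
  {D | nuclearNorm D ≤ t ∧ ∀ i j, 0 ≤ (Fu * D * Fvᵀ) i j ∧ (Fu * D * Fvᵀ) i j ≤ 1}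

/-- `D` is an optimal solution of inductive shifted matrix completion for the 0-1 matrix `A`. -/
def IsInductiveShiftMC {m n d : ℕ} (Fu : Matrix (Fin m) (Fin d) ℝ)
    (Fv : Matrix (Fin n) (Fin d) ℝ) (ρ t : ℝ) (A : Matrix (Fin m) (Fin n) (Fin 2))
    (D : Matrix (Fin d) (Fin d) ℝ) : Prop :=
  D ∈ inductiveFeasible Fu Fv t ∧
    IsMinOn (fun D' => ∑ i, ∑ j, shiftLoss ρ ((Fu * D' * Fvᵀ) i j) (A i j))
      (inductiveFeasible Fu Fv t) D

end

/-! The shifted loss is the squared loss against `A / (1 - ρ)`, an unbiased estimator of `M`, up to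
a term independent of the prediction. The matrix `Fuᵀ * M * Fv` is feasible and reproduces `M`
(`nuclearNorm_features`), so comparing a minimizer with it bounds the squared error by twice the
correlation of the error with the centered noise, hence by its supremum `puSup` over the feasible
set (`sum_sq_error_le_puSup`).

This supremum concentrates: changing one entry of `A` moves it by at most `2 / (1 - ρ)`, so
McDiarmid's inequality (`sum_prod_le_exp_of_le_sub_mean`) gives the first term of the bound. Its
mean gives the second term (`mean_puSup_le`): by Cauchy-Schwarz and Frobenius ≤ nuclear it is at
most `2 * t` times the expected Frobenius norm of `Fuᵀ * noise * Fv`, which Jensen and independence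
control through the entry variances. No symmetrization or spectral-norm estimate is used, so no
logarithm of `d` arises.

All expectations are finite sums over 0-1 matrices with product weights; the measure `P` enters only
at the end. -/

/-! ### Nuclear norm via the spectrum of the Gram matrix. -/

theorem charpoly_adjoint_comp_toEuclideanLin {m n : ℕ} (X : Matrix (Fin m) (Fin n) ℝ) :
    (LinearMap.adjoint (toEuclideanLin X) ∘ₗ toEuclideanLin X).charpoly = (Xᵀ * X).charpoly := by
  rw [← toEuclideanLin_conjTranspose_eq_adjoint, ← toLpLin_mul,
    conjTranspose_eq_transpose_of_trivial]
  change (toEuclideanLin (Xᵀ * X)).charpoly = _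
  rw [toEuclideanLin_eq_toLin_orthonormal, charpoly_toLin]

theorem nuclearNorm_eq_sum_fin {m n : ℕ} (X : Matrix (Fin m) (Fin n) ℝ) :
    nuclearNorm X = ∑ k : Fin n, (toEuclideanLin X).singularValues k := by
  rw [nuclearNorm, Finset.sum_range]

/-- The nuclear norm is the sum of the square roots of the roots of the characteristic polynomial
of the Gram matrix. -/
theorem nuclearNorm_eq_sum_sqrt_roots {m n : ℕ} (X : Matrix (Fin m) (Fin n) ℝ) :
    nuclearNorm X = ((Xᵀ * X).charpoly.roots.map Real.sqrt).sum := by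
  rw [nuclearNorm_eq_sum_fin, ← charpoly_adjoint_comp_toEuclideanLin,
    (toEuclideanLin X).isSymmetric_adjoint_comp_self.roots_charpoly_eq_eigenvalues
      (finrank_euclideanSpace_fin (𝕜 := ℝ) (n := n)), Multiset.map_map]
  simp_rw [(toEuclideanLin X).singularValues_fin (finrank_euclideanSpace_fin (𝕜 := ℝ) (n := n))]
  rfl

theorem nuclearNorm_nonneg {m n : ℕ} (X : Matrix (Fin m) (Fin n) ℝ) : 0 ≤ nuclearNorm X :=
  Finset.sum_nonneg fun k _ => LinearMap.singularValues_nonneg _ k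

/-- Both sides are the trace of `Xᵀ * X`, read off its eigenvalues and off its entries. -/
theorem sum_sq_singularValues {m n : ℕ} (X : Matrix (Fin m) (Fin n) ℝ) :
    ∑ k : Fin n, (toEuclideanLin X).singularValues k ^ 2 = ∑ i, ∑ j, X i j ^ 2 := by
  have h : (Xᵀ * X).trace = (Xᵀ * X).charpoly.roots.sum :=
    trace_eq_sum_roots_charpoly_of_splits
      (isHermitian_conjTranspose_mul_self X).splits_charpoly
  have h2 : (Xᵀ * X).trace = ∑ i, ∑ j, X i j ^ 2 := by
    simp only [trace, diag_apply, mul_apply, transpose_apply]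
    rw [Finset.sum_comm]
    simp only [sq]
  rw [← h2, h, ← charpoly_adjoint_comp_toEuclideanLin,
    (toEuclideanLin X).isSymmetric_adjoint_comp_self.roots_charpoly_eq_eigenvalues
      (finrank_euclideanSpace_fin (𝕜 := ℝ) (n := n))]
  simp_rw [(toEuclideanLin X).sq_singularValues_fin (finrank_euclideanSpace_fin (𝕜 := ℝ) (n := n))]
  rfl

/-- The Frobenius norm is at most the nuclear norm. -/
theorem sum_sq_le_nuclearNorm_sq {m n : ℕ} (X : Matrix (Fin m) (Fin n) ℝ) :
    ∑ i, ∑ j, X i j ^ 2 ≤ nuclearNorm X ^ 2 := by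
  rw [← sum_sq_singularValues, nuclearNorm_eq_sum_fin]
  exact Finset.sum_sq_le_sq_sum_of_nonneg fun k _ => LinearMap.singularValues_nonneg _ k

/-- The nonzero roots of the characteristic polynomials of `A * B` and `B * A` agree. -/
theorem sum_sqrt_roots_charpoly_mul_comm {m n : ℕ} (A : Matrix (Fin m) (Fin n) ℝ)
    (B : Matrix (Fin n) (Fin m) ℝ) :
    ((A * B).charpoly.roots.map Real.sqrt).sum = ((B * A).charpoly.roots.map Real.sqrt).sum := by
  -- The two characteristic polynomials agree up to powers of `X`, whose roots are zero and add
  -- nothing to the sum.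
  have h := congrArg (fun p : Polynomial ℝ => (p.roots.map Real.sqrt).sum) (charpoly_mul_comm' A B)
  rw [Polynomial.roots_mul (mul_ne_zero (pow_ne_zero _ Polynomial.X_ne_zero)
      (charpoly_monic _).ne_zero), Polynomial.roots_mul (mul_ne_zero (pow_ne_zero _
      Polynomial.X_ne_zero) (charpoly_monic _).ne_zero)] at h
  simpa [Multiset.map_nsmul, Multiset.sum_nsmul] using h

/-- If `M = F Fᵀ M G Gᵀ` then `Fᵀ M G` has the same nuclear norm as `M`. -/
theorem nuclearNorm_features {m n d : ℕ} (F : Matrix (Fin m) (Fin d) ℝ)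
    (G : Matrix (Fin n) (Fin d) ℝ) (M : Matrix (Fin m) (Fin n) ℝ)
    (hM : M = F * Fᵀ * M * (G * Gᵀ)) : nuclearNorm (Fᵀ * M * G) = nuclearNorm M := by
  -- Moving the leading `Gᵀ` of this Gram matrix to the right end keeps the nonzero spectrum and
  -- assembles the right side of `hM`, leaving `Mᵀ * M`.
  have h1 : (Fᵀ * M * G)ᵀ * (Fᵀ * M * G) = Gᵀ * (Mᵀ * (F * Fᵀ * M) * G) := by
    simp only [transpose_mul, transpose_transpose, Matrix.mul_assoc]
  have h2 : Mᵀ * (F * Fᵀ * M) * G * Gᵀ = Mᵀ * M := by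
    rw [Matrix.mul_assoc, Matrix.mul_assoc, ← hM]
  rw [nuclearNorm_eq_sum_sqrt_roots, nuclearNorm_eq_sum_sqrt_roots, h1,
    sum_sqrt_roots_charpoly_mul_comm, h2]

/-! ### Moments and concentration under finite product weights. -/

section FiniteProduct

variable {α : Type*} [Fintype α]

theorem sum_prod_apply {ι : Type*} [Fintype ι] [DecidableEq ι] (g : ι → α → ℝ) :
    ∑ x : ι → α, ∏ i, g i (x i) = ∏ i, ∑ a, g i a := by
  rw [Finset.prod_univ_sum, Fintype.piFinset_univ]

/-- Under a product weight, the second moment of a sum of centered coordinates is the sum of the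
second moments. -/
theorem sum_prod_mul_sum_sq {ι : Type*} [Fintype ι] [DecidableEq ι] (w z : ι → α → ℝ) (hw1 : ∀ i, ∑ a, w i a = 1)
    (hz : ∀ i, ∑ a, w i a * z i a = 0) (c : ι → ℝ) :
    ∑ x : ι → α, (∏ i, w i (x i)) * (∑ i, c i * z i (x i)) ^ 2 =
      ∑ i, c i ^ 2 * ∑ a, w i a * z i a ^ 2 := by
  have key : ∀ p q : ι, ∑ x : ι → α, (∏ i, w i (x i)) * (z p (x p) * z q (x q)) =
      if p = q then ∑ a, w p a * z p a ^ 2 else 0 := by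
    intro p q
    -- The factors at `p` and `q` are absorbed into the product by indicators, so that the sum
    -- factors over coordinates.
    have h1 : ∀ x : ι → α, (∏ i, w i (x i)) * (z p (x p) * z q (x q)) =
        ∏ i, (w i (x i) * ((if i = p then z i (x i) else 1) *
          (if i = q then z i (x i) else 1))) := by
      intro x
      rw [Finset.prod_mul_distrib, Finset.prod_mul_distrib]
      simp
    simp_rw [h1]
    rw [sum_prod_apply (fun i a => w i a * ((if i = p then z i a else 1) *
      (if i = q then z i a else 1)))]
    split_ifs with hpq
    · subst hpq
      rw [Finset.prod_eq_single p]
      · simp [sq]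
      · intro i _ hi
        simp [hi, hw1]
      · simp
    · apply Finset.prod_eq_zero (Finset.mem_univ p)
      simp [hpq, hz]
  calc ∑ x : ι → α, (∏ i, w i (x i)) * (∑ i, c i * z i (x i)) ^ 2
      = ∑ x : ι → α, ∑ p, ∑ q, c p * c q * ((∏ i, w i (x i)) * (z p (x p) * z q (x q))) := by
        refine Finset.sum_congr rfl fun x _ => ?_
        rw [sq, Finset.sum_mul_sum, Finset.mul_sum]
        refine Finset.sum_congr rfl fun p _ => ?_
        rw [Finset.mul_sum]
        exact Finset.sum_congr rfl fun q _ => by ring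
    _ = ∑ p, ∑ q, c p * c q * (if p = q then ∑ a, w p a * z p a ^ 2 else 0) := by
        rw [Finset.sum_comm]
        refine Finset.sum_congr rfl fun p _ => ?_
        rw [Finset.sum_comm]
        refine Finset.sum_congr rfl fun q _ => ?_
        rw [← key, Finset.mul_sum]
    _ = _ := by simp [sq]

/-- Under a product weight, centered coordinates have mean zero. -/
theorem sum_prod_mul_apply_eq_zero {ι : Type*} [Fintype ι] [DecidableEq ι] (w z : ι → α → ℝ)
    (hz : ∀ i, ∑ a, w i a * z i a = 0) (p : ι) :
    ∑ x : ι → α, (∏ i, w i (x i)) * z p (x p) = 0 := by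
  have h1 : ∀ x : ι → α, (∏ i, w i (x i)) * z p (x p) =
      ∏ i, (w i (x i) * (if i = p then z i (x i) else 1)) := by
    intro x
    rw [Finset.prod_mul_distrib]
    simp
  simp_rw [h1]
  rw [sum_prod_apply (fun i a => w i a * (if i = p then z i a else 1))]
  apply Finset.prod_eq_zero (Finset.mem_univ p)
  simp [hz]

/-- Jensen's inequality for the square root of a weighted sum. -/
theorem sum_mul_sqrt_le (w f : α → ℝ) (hw : ∀ a, 0 ≤ w a) (hw1 : ∑ a, w a = 1)
    (hf : ∀ a, 0 ≤ f a) : ∑ a, w a * √(f a) ≤ √(∑ a, w a * f a) := by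
  apply Real.le_sqrt_of_sq_le
  have := Finset.sum_mul_sq_le_sq_mul_sq Finset.univ (fun a => √(w a)) (fun a => √(w a) * √(f a))
  simpa only [mul_pow, ← mul_assoc, Real.mul_self_sqrt (hw _), Real.sq_sqrt (hw _),
    Real.sq_sqrt (hf _), hw1, one_mul] using this

/-- Hoeffding's lemma for a centered function bounded in absolute value, under a finite weight. -/
theorem sum_mul_exp_le (w x : α → ℝ) (hw : ∀ a, 0 ≤ w a) (hw1 : ∑ a, w a = 1)
    (hx : ∑ a, w a * x a = 0) (c : ℝ) (hc : 0 < c) (hxc : ∀ a, |x a| ≤ c) (r : ℝ) :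
    ∑ a, w a * Real.exp (r * x a) ≤ Real.exp (r ^ 2 * c ^ 2 / 2) := by
  have hpt : ∀ a, Real.exp (r * x a) ≤ Real.cosh (r * c) + x a / c * Real.sinh (r * c) := by
    intro a
    obtain ⟨h1, h2⟩ := abs_le.1 (hxc a)
    have h1' : -1 ≤ x a / c := by rw [le_div_iff₀ hc]; linarith
    have h2' : x a / c ≤ 1 := by rw [div_le_iff₀ hc]; linarith
    -- `r * x a` is a convex combination of `r * c` and `-(r * c)`; the chord of `exp` is affine in
    -- `x a`, so only its `cosh` part survives averaging.
    have := convexOn_exp.2 (Set.mem_univ (r * c)) (Set.mem_univ (-(r * c)))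
      (by linarith : 0 ≤ (1 + x a / c) / 2) (by linarith : 0 ≤ (1 - x a / c) / 2) (by ring)
    simp only [smul_eq_mul] at this
    have e : (1 + x a / c) / 2 * (r * c) + (1 - x a / c) / 2 * -(r * c) = r * x a := by
      field_simp
      ring
    rw [e] at this
    rw [Real.cosh_eq, Real.sinh_eq]
    linarith
  calc ∑ a, w a * Real.exp (r * x a)
      ≤ ∑ a, w a * (Real.cosh (r * c) + x a / c * Real.sinh (r * c)) :=
        Finset.sum_le_sum fun a _ => mul_le_mul_of_nonneg_left (hpt a) (hw a)
    _ = (∑ a, w a) * Real.cosh (r * c) + (∑ a, w a * x a) * (Real.sinh (r * c) / c) := by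
        rw [Finset.sum_mul, Finset.sum_mul, ← Finset.sum_add_distrib]
        exact Finset.sum_congr rfl fun a _ => by ring
    _ ≤ Real.exp ((r * c) ^ 2 / 2) := by
        rw [hw1, hx, one_mul, zero_mul, add_zero]
        exact Real.cosh_le_exp_half_sq _
    _ = _ := by rw [mul_pow]

/-- Conditioning on the first coordinate, for the induction on `N`. -/
theorem sum_fin_succ_arrow {N : ℕ} (w : Fin (N + 1) → α → ℝ) (g : (Fin (N + 1) → α) → ℝ) :
    ∑ x : Fin (N + 1) → α, (∏ i, w i (x i)) * g x =
      ∑ a, w 0 a * ∑ y : Fin N → α, (∏ i, w i.succ (y i)) * g (Fin.cons a y) := by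
  rw [← (Fin.consEquiv fun _ => α).sum_comp, Fintype.sum_prod_type]
  refine Finset.sum_congr rfl fun a _ => ?_
  rw [Finset.mul_sum]
  refine Finset.sum_congr rfl fun y _ => ?_
  simp [Fin.consEquiv, Fin.prod_univ_succ, mul_assoc]

/-- The exponential moment bound behind McDiarmid's inequality, over `Fin N`. -/
theorem sum_prod_mul_exp_le_fin {N : ℕ} (w : Fin N → α → ℝ) (hw : ∀ i a, 0 ≤ w i a)
    (hw1 : ∀ i, ∑ a, w i a = 1) (f : (Fin N → α) → ℝ) (c : ℝ) (hc : 0 < c)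
    (hf : ∀ x i a, f x - f (Function.update x i a) ≤ c) (r : ℝ) :
    ∑ x : Fin N → α, (∏ i, w i (x i)) *
        Real.exp (r * (f x - ∑ y : Fin N → α, (∏ i, w i (y i)) * f y)) ≤
      Real.exp (N * (r ^ 2 * c ^ 2 / 2)) := by
  induction N with
  | zero => simp
  | succ N ih =>
    set μ := ∑ y : Fin (N + 1) → α, (∏ i, w i (y i)) * f y with hμ
    -- The conditional mean of `f` given the first coordinate; `h a - μ` is the first martingale
    -- difference.
    set h : α → ℝ := fun a => ∑ y : Fin N → α, (∏ i, w i.succ (y i)) * f (Fin.cons a y) with hh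
    have hW1 : ∑ y : Fin N → α, ∏ i, w i.succ (y i) = 1 := by
      rw [sum_prod_apply (fun (i : Fin N) a => w i.succ a)]
      simp [hw1]
    have hμ' : μ = ∑ a, w 0 a * h a := sum_fin_succ_arrow w f
    have hhdiff : ∀ a b, h a - h b ≤ c := by
      intro a b
      rw [hh]
      simp only
      rw [← Finset.sum_sub_distrib]
      calc _ ≤ ∑ y : Fin N → α, (∏ i, w i.succ (y i)) * c := by
            refine Finset.sum_le_sum fun y _ => ?_
            rw [← mul_sub]
            refine mul_le_mul_of_nonneg_left ?_ (Finset.prod_nonneg fun i _ => hw _ _)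
            have := hf (Fin.cons a y) 0 b
            rwa [Fin.update_cons_zero] at this
        _ = c := by rw [← Finset.sum_mul, hW1, one_mul]
    -- Keeping only this two-sided bound, rather than the range of length `c`, is what loses the
    -- factor 4 in the exponent.
    have habs : ∀ a, |h a - μ| ≤ c := by
      intro a
      have e1 : h a - μ = ∑ b, w 0 b * (h a - h b) := by
        simp only [mul_sub, Finset.sum_sub_distrib, ← Finset.sum_mul, hw1, one_mul, hμ']
      have e2 : μ - h a = ∑ b, w 0 b * (h b - h a) := by
        simp only [mul_sub, Finset.sum_sub_distrib, ← Finset.sum_mul, hw1, one_mul, hμ']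
      have e3 : ∑ b, w 0 b * c = c := by rw [← Finset.sum_mul, hw1, one_mul]
      rw [abs_sub_le_iff, e1, e2]
      exact ⟨(Finset.sum_le_sum fun b _ => mul_le_mul_of_nonneg_left (hhdiff _ _) (hw _ _)).trans
          e3.le, (Finset.sum_le_sum fun b _ => mul_le_mul_of_nonneg_left (hhdiff _ _)
          (hw _ _)).trans e3.le⟩
    rw [sum_fin_succ_arrow]
    calc _ = ∑ a, w 0 a * (Real.exp (r * (h a - μ)) * ∑ y : Fin N → α,
            (∏ i, w i.succ (y i)) * Real.exp (r * (f (Fin.cons a y) - h a))) := by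
          refine Finset.sum_congr rfl fun a _ => ?_
          congr 1
          rw [Finset.mul_sum]
          refine Finset.sum_congr rfl fun y _ => ?_
          rw [mul_left_comm, ← Real.exp_add]
          ring_nf
      _ ≤ ∑ a, w 0 a * (Real.exp (r * (h a - μ)) * Real.exp (N * (r ^ 2 * c ^ 2 / 2))) := by
          refine Finset.sum_le_sum fun a _ => mul_le_mul_of_nonneg_left
            (mul_le_mul_of_nonneg_left ?_ (Real.exp_nonneg _)) (hw _ _)
          refine ih (fun i => w i.succ) (fun i => hw _) (fun i => hw1 _)
            (fun y => f (Fin.cons a y)) fun y i b => ?_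
          have := hf (Fin.cons a y) i.succ b
          rwa [← Fin.cons_update] at this
      _ = (∑ a, w 0 a * Real.exp (r * (h a - μ))) * Real.exp (N * (r ^ 2 * c ^ 2 / 2)) := by
          rw [Finset.sum_mul]
          exact Finset.sum_congr rfl fun a _ => by ring
      _ ≤ Real.exp (r ^ 2 * c ^ 2 / 2) * Real.exp (N * (r ^ 2 * c ^ 2 / 2)) := by
          refine mul_le_mul_of_nonneg_right ?_ (Real.exp_nonneg _)
          refine sum_mul_exp_le (w 0) (fun a => h a - μ) (hw 0) (hw1 0) ?_ c hc habs r
          simp only [mul_sub, Finset.sum_sub_distrib, ← Finset.sum_mul, hw1, one_mul, hμ', sub_self]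
      _ = _ := by
          rw [← Real.exp_add]
          push_cast
          ring_nf

/-- **McDiarmid's inequality** (with a suboptimal constant) for a finite product weight. -/
theorem sum_prod_le_exp_of_le_sub_mean {ι : Type*} [Fintype ι] [DecidableEq ι] (w : ι → α → ℝ) (hw : ∀ i a, 0 ≤ w i a)
    (hw1 : ∀ i, ∑ a, w i a = 1) (f : (ι → α) → ℝ) (c : ℝ) (hc : 0 < c)
    (hf : ∀ x i a, f x - f (Function.update x i a) ≤ c) (hι : 0 < Fintype.card ι)
    (s : ℝ) (hs : 0 ≤ s) (S : Finset (ι → α))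
    (hS : ∀ x ∈ S, s ≤ f x - ∑ y, (∏ i, w i (y i)) * f y) :
    ∑ x ∈ S, ∏ i, w i (x i) ≤
      Real.exp (-(s ^ 2 / (2 * Fintype.card ι * c ^ 2))) := by
  set N := Fintype.card ι
  let e : ι ≃ Fin N := Fintype.equivFin ι
  set μ := ∑ y, (∏ i, w i (y i)) * f y with hμ
  have hsum : ∀ g : (ι → α) → ℝ, ∑ x, (∏ i, w i (x i)) * g x =
      ∑ y : Fin N → α, (∏ j, w (e.symm j) (y j)) * g (y ∘ e) := by
    intro g
    rw [← (e.symm.arrowCongr (Equiv.refl α)).sum_comp]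
    refine Finset.sum_congr rfl fun y _ => ?_
    congr 1
    rw [← e.symm.prod_comp]
    simp [Equiv.arrowCongr]
  have hmgf : ∀ r : ℝ, ∑ x, (∏ i, w i (x i)) * Real.exp (r * (f x - μ)) ≤
      Real.exp (N * (r ^ 2 * c ^ 2 / 2)) := by
    intro r
    rw [hsum, hμ, hsum]
    refine sum_prod_mul_exp_le_fin (fun j => w (e.symm j)) (fun j => hw _) (fun j => hw1 _)
      (fun y => f (y ∘ e)) c hc (fun y j a => ?_) r
    have := hf (y ∘ e) (e.symm j) a
    rwa [← Function.update_comp_equiv] at this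
  have hN : (0 : ℝ) < N := by exact_mod_cast hι
  -- The minimizer of the Chernoff exponent `-(r * s) + N * r ^ 2 * c ^ 2 / 2`.
  set r := s / (N * c ^ 2) with hr
  have hr0 : 0 ≤ r := by positivity
  calc ∑ x ∈ S, ∏ i, w i (x i)
      ≤ ∑ x ∈ S, (∏ i, w i (x i)) * Real.exp (r * (f x - μ) - r * s) := by
        refine Finset.sum_le_sum fun x hx => ?_
        refine le_mul_of_one_le_right (Finset.prod_nonneg fun i _ => hw _ _) ?_
        rw [Real.one_le_exp_iff, ← mul_sub]
        exact mul_nonneg hr0 (sub_nonneg.2 (hS x hx))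
    _ ≤ ∑ x, (∏ i, w i (x i)) * Real.exp (r * (f x - μ) - r * s) :=
        Finset.sum_le_sum_of_subset_of_nonneg (Finset.subset_univ _) fun x _ _ =>
          mul_nonneg (Finset.prod_nonneg fun i _ => hw _ _) (Real.exp_nonneg _)
    _ = Real.exp (-(r * s)) * ∑ x, (∏ i, w i (x i)) * Real.exp (r * (f x - μ)) := by
        rw [Finset.mul_sum]
        refine Finset.sum_congr rfl fun x _ => ?_
        rw [sub_eq_add_neg, Real.exp_add]
        ring
    _ ≤ Real.exp (-(r * s)) * Real.exp (N * (r ^ 2 * c ^ 2 / 2)) :=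
        mul_le_mul_of_nonneg_left (hmgf r) (Real.exp_nonneg _)
    _ = _ := by
        rw [← Real.exp_add, hr]
        congr 1
        field_simp
        ring

end FiniteProduct

/-! ### The one-entry law, its noise and the shifted loss. -/

/-- The law of an entry of the observed matrix. -/
def puWeight {m n : ℕ} (M : Matrix (Fin m) (Fin n) ℝ) (ρ : ℝ) (p : Fin m × Fin n) (a : Fin 2) : ℝ :=
  if a = 1 then M p.1 p.2 * (1 - ρ) else 1 - M p.1 p.2 * (1 - ρ)

/-- The centered noise of the rescaled observation `A / (1 - ρ)`. -/
noncomputable def puNoise {m n : ℕ} (M : Matrix (Fin m) (Fin n) ℝ) (ρ : ℝ) (p : Fin m × Fin n)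
    (a : Fin 2) : ℝ :=
  (if a = 1 then 1 / (1 - ρ) else 0) - M p.1 p.2

/-- The largest correlation of the noise with the error of a feasible point. -/
noncomputable def puSup {m n d : ℕ} (Fu : Matrix (Fin m) (Fin d) ℝ) (Fv : Matrix (Fin n) (Fin d) ℝ)
    (M : Matrix (Fin m) (Fin n) ℝ) (ρ t : ℝ) (x : Fin m × Fin n → Fin 2) : ℝ :=
  ⨆ D : inductiveFeasible Fu Fv t,
    2 * ∑ p : Fin m × Fin n, ((Fu * D.1 * Fvᵀ) p.1 p.2 - M p.1 p.2) * puNoise M ρ p (x p)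

section Weights

variable {m n : ℕ} {M : Matrix (Fin m) (Fin n) ℝ} {ρ : ℝ}

theorem puWeight_nonneg (hM01 : ∀ i j, 0 ≤ M i j ∧ M i j ≤ 1) (hρ0 : 0 ≤ ρ) (hρ1 : ρ < 1)
    (p : Fin m × Fin n) (a : Fin 2) : 0 ≤ puWeight M ρ p a := by
  obtain ⟨h0, h1⟩ := hM01 p.1 p.2
  unfold puWeight
  split_ifs
  · exact mul_nonneg h0 (by linarith)
  · nlinarith

theorem sum_puWeight (p : Fin m × Fin n) : ∑ a, puWeight M ρ p a = 1 := by
  simp [Fin.sum_univ_two, puWeight]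

theorem sum_puWeight_mul_puNoise (hρ1 : ρ < 1) (p : Fin m × Fin n) :
    ∑ a, puWeight M ρ p a * puNoise M ρ p a = 0 := by
  have hq : 1 - ρ ≠ 0 := by linarith
  simp only [Fin.sum_univ_two, puWeight, puNoise, zero_ne_one, if_true, if_false]
  field_simp
  ring

/-- The variance is exactly `M / (1 - ρ) - M ^ 2`; this is the source of `√(1 - ρ)` in the second
term of the bound. -/
theorem sum_puWeight_mul_puNoise_sq_le (hM01 : ∀ i j, 0 ≤ M i j ∧ M i j ≤ 1) (hρ1 : ρ < 1)
    (p : Fin m × Fin n) :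
    ∑ a, puWeight M ρ p a * puNoise M ρ p a ^ 2 ≤ 1 / (1 - ρ) := by
  have hq : 0 < 1 - ρ := by linarith
  obtain ⟨h0, h1⟩ := hM01 p.1 p.2
  have e : ∑ a, puWeight M ρ p a * puNoise M ρ p a ^ 2 =
      M p.1 p.2 * (1 / (1 - ρ)) - M p.1 p.2 ^ 2 := by
    simp only [Fin.sum_univ_two, puWeight, puNoise, zero_ne_one, if_true, if_false]
    field_simp
    ring
  have : 0 < 1 / (1 - ρ) := by positivity
  rw [e]
  nlinarith [sq_nonneg (M p.1 p.2)]

theorem abs_puNoise_sub_le (hρ1 : ρ < 1) (p : Fin m × Fin n) (a b : Fin 2) :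
    |puNoise M ρ p a - puNoise M ρ p b| ≤ 1 / (1 - ρ) := by
  have : 0 < 1 / (1 - ρ) := one_div_pos.2 (by linarith)
  unfold puNoise
  rw [sub_sub_sub_cancel_right]
  split_ifs <;> simp only [sub_self, abs_zero, sub_zero, zero_sub, abs_neg, abs_of_pos this,
    le_refl, this.le]

/-- With `b = a / (1 - ρ)`, which is noise plus `M`, the loss is `y ^ 2 - 2 * y * b + b`: a square
completed only up to a term free of `y`. -/
theorem shiftLoss_eq (hρ1 : ρ < 1) (y : ℝ) (p : Fin m × Fin n) (a : Fin 2) :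
    shiftLoss ρ y a = y ^ 2 - 2 * y * (puNoise M ρ p a + M p.1 p.2) +
      (puNoise M ρ p a + M p.1 p.2) := by
  have hq : 1 - ρ ≠ 0 := by linarith
  unfold shiftLoss puNoise
  split_ifs
  · field_simp
    ring
  · ring

end Weights

theorem sum_sq_row_le_maxRowNorm_sq {m d : ℕ} (F : Matrix (Fin m) (Fin d) ℝ) (i : Fin m) :
    ∑ k, F i k ^ 2 ≤ maxRowNorm F ^ 2 := by
  have h0 : 0 ≤ ∑ k, F i k ^ 2 := Finset.sum_nonneg fun k _ => sq_nonneg _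
  have h : √(∑ k, F i k ^ 2) ≤ maxRowNorm F :=
    le_ciSup (f := fun i => √(∑ k, F i k ^ 2)) (Set.finite_range _).bddAbove i
  calc ∑ k, F i k ^ 2 = √(∑ k, F i k ^ 2) ^ 2 := (Real.sq_sqrt h0).symm
    _ ≤ _ := pow_le_pow_left₀ (Real.sqrt_nonneg _) h 2

theorem maxRowNorm_nonneg {m d : ℕ} (F : Matrix (Fin m) (Fin d) ℝ) : 0 ≤ maxRowNorm F :=
  Real.iSup_nonneg fun _ => Real.sqrt_nonneg _

/-! ### The supremum of the noise process: bounded differences, mean, and control of the error. -/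

section NoiseSup

variable {m n d : ℕ} {Fu : Matrix (Fin m) (Fin d) ℝ} {Fv : Matrix (Fin n) (Fin d) ℝ}
  {M : Matrix (Fin m) (Fin n) ℝ} {ρ t : ℝ}

theorem abs_sub_le_one_of_feasible (hM01 : ∀ i j, 0 ≤ M i j ∧ M i j ≤ 1)
    {D : Matrix (Fin d) (Fin d) ℝ} (hD : D ∈ inductiveFeasible Fu Fv t) (i : Fin m) (j : Fin n) :
    |(Fu * D * Fvᵀ) i j - M i j| ≤ 1 := by
  obtain ⟨h0, h1⟩ := hM01 i j
  obtain ⟨h2, h3⟩ := hD.2 i j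
  rw [abs_le]
  constructor <;> linarith

theorem le_puSup (hM01 : ∀ i j, 0 ≤ M i j ∧ M i j ≤ 1) {D : Matrix (Fin d) (Fin d) ℝ}
    (hD : D ∈ inductiveFeasible Fu Fv t) (x : Fin m × Fin n → Fin 2) :
    2 * ∑ p : Fin m × Fin n, ((Fu * D * Fvᵀ) p.1 p.2 - M p.1 p.2) * puNoise M ρ p (x p) ≤
      puSup Fu Fv M ρ t x := by
  refine le_ciSup (f := fun D : inductiveFeasible Fu Fv t => 2 * ∑ p : Fin m × Fin n,
    ((Fu * D.1 * Fvᵀ) p.1 p.2 - M p.1 p.2) * puNoise M ρ p (x p)) ?_ ⟨D, hD⟩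
  -- A bound uniform in `D`, so that the real supremum is genuine and not the default value 0.
  refine ⟨2 * ∑ p : Fin m × Fin n, |puNoise M ρ p (x p)|, ?_⟩
  rintro _ ⟨E, rfl⟩
  refine mul_le_mul_of_nonneg_left (Finset.sum_le_sum fun p _ => ?_) zero_le_two
  refine (le_abs_self _).trans ?_
  rw [abs_mul]
  exact mul_le_of_le_one_left (abs_nonneg _) (abs_sub_le_one_of_feasible hM01 E.2 _ _)

theorem puSup_sub_update_le (hM01 : ∀ i j, 0 ≤ M i j ∧ M i j ≤ 1) (hρ1 : ρ < 1)
    (hne : (inductiveFeasible Fu Fv t).Nonempty) (x : Fin m × Fin n → Fin 2)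
    (i : Fin m × Fin n) (a : Fin 2) :
    puSup Fu Fv M ρ t x - puSup Fu Fv M ρ t (Function.update x i a) ≤ 2 / (1 - ρ) := by
  have := hne.to_subtype
  rw [sub_le_iff_le_add]
  refine ciSup_le fun D => ?_
  have h1 := le_puSup (ρ := ρ) hM01 D.2 (Function.update x i a)
  have h2 : ∑ p : Fin m × Fin n, ((Fu * D.1 * Fvᵀ) p.1 p.2 - M p.1 p.2) * puNoise M ρ p (x p) -
      ∑ p : Fin m × Fin n, ((Fu * D.1 * Fvᵀ) p.1 p.2 - M p.1 p.2) *
        puNoise M ρ p (Function.update x i a p) ≤ 1 / (1 - ρ) := by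
    rw [← Finset.sum_sub_distrib, Finset.sum_eq_single i]
    · rw [← mul_sub, Function.update_self]
      refine (le_abs_self _).trans ?_
      rw [abs_mul, ← one_mul (1 / (1 - ρ))]
      exact mul_le_mul (abs_sub_le_one_of_feasible hM01 D.2 _ _) (abs_puNoise_sub_le hρ1 _ _ _)
        (abs_nonneg _) zero_le_one
    · intro p _ hp
      rw [Function.update_of_ne hp, sub_self]
    · simp
  have e : 2 / (1 - ρ) = 2 * (1 / (1 - ρ)) := by ring
  rw [e]
  linarith

/-- The pairing of `Fu D Fvᵀ` with a matrix is bounded by the Frobenius norm of `D` times that of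
the compressed matrix. -/
theorem sum_bilinear_mul_le (D : Matrix (Fin d) (Fin d) ℝ) (z : Fin m × Fin n → ℝ) :
    ∑ p : Fin m × Fin n, (Fu * D * Fvᵀ) p.1 p.2 * z p ≤
      √(∑ k, ∑ l, D k l ^ 2) * √(∑ k, ∑ l, (∑ p, Fu p.1 k * Fv p.2 l * z p) ^ 2) := by
  have e : ∑ p : Fin m × Fin n, (Fu * D * Fvᵀ) p.1 p.2 * z p =
      ∑ r : Fin d × Fin d, D r.1 r.2 * ∑ p, Fu p.1 r.1 * Fv p.2 r.2 * z p := by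
    conv_rhs => rw [Fintype.sum_prod_type]
    simp only [mul_apply, transpose_apply, Finset.mul_sum, Finset.sum_mul]
    refine (Finset.sum_congr rfl fun p _ => Finset.sum_comm).trans ?_
    rw [Finset.sum_comm]
    refine Finset.sum_congr rfl fun k _ => ?_
    rw [Finset.sum_comm]
    exact Finset.sum_congr rfl fun l _ => Finset.sum_congr rfl fun p _ => by ring
  rw [e, ← Fintype.sum_prod_type (f := fun r : Fin d × Fin d => D r.1 r.2 ^ 2),
    ← Fintype.sum_prod_type (f := fun r : Fin d × Fin d => (∑ p, Fu p.1 r.1 * Fv p.2 r.2 * z p) ^ 2)]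
  exact Real.sum_mul_le_sqrt_mul_sqrt _ _ _

/-- Cauchy-Schwarz in the Frobenius inner product removes the supremum, since the Frobenius norm of
a feasible `D` is at most `t`. The part involving `M` does not depend on `D` and is kept exact,
because its mean vanishes. -/
theorem puSup_le (hne : (inductiveFeasible Fu Fv t).Nonempty) (x : Fin m × Fin n → Fin 2) :
    puSup Fu Fv M ρ t x ≤
      2 * (t * √(∑ k, ∑ l, (∑ p, Fu p.1 k * Fv p.2 l * puNoise M ρ p (x p)) ^ 2)) -
        2 * ∑ p, M p.1 p.2 * puNoise M ρ p (x p) := by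
  have := hne.to_subtype
  refine ciSup_le fun D => ?_
  have h1 := sum_bilinear_mul_le (Fu := Fu) (Fv := Fv) D.1 fun p => puNoise M ρ p (x p)
  have h2 : √(∑ k, ∑ l, D.1 k l ^ 2) ≤ t :=
    (Real.sqrt_le_left (nuclearNorm_nonneg _)).2 (sum_sq_le_nuclearNorm_sq D.1) |>.trans D.2.1
  have h3 := mul_le_mul_of_nonneg_right h2 (Real.sqrt_nonneg
    (∑ k, ∑ l, (∑ p, Fu p.1 k * Fv p.2 l * puNoise M ρ p (x p)) ^ 2))
  simp only [sub_mul, Finset.sum_sub_distrib]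
  linarith

theorem mean_puSup_le (hM01 : ∀ i j, 0 ≤ M i j ∧ M i j ≤ 1) (hρ0 : 0 ≤ ρ) (hρ1 : ρ < 1)
    (ht : 0 ≤ t) (hne : (inductiveFeasible Fu Fv t).Nonempty) :
    ∑ x : Fin m × Fin n → Fin 2, (∏ p, puWeight M ρ p (x p)) * puSup Fu Fv M ρ t x ≤
      2 * (t * (√((m : ℝ) * n) / √(1 - ρ) * (maxRowNorm Fu * maxRowNorm Fv))) := by
  have hq : 0 < 1 - ρ := by linarith
  have hw := puWeight_nonneg hM01 hρ0 hρ1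
  have hW : ∀ x : Fin m × Fin n → Fin 2, 0 ≤ ∏ p, puWeight M ρ p (x p) :=
    fun x => Finset.prod_nonneg fun p _ => hw _ _
  have hW1 : ∑ x : Fin m × Fin n → Fin 2, ∏ p, puWeight M ρ p (x p) = 1 := by
    rw [sum_prod_apply (puWeight M ρ)]
    simp only [sum_puWeight, Finset.prod_const_one]
  have hU := maxRowNorm_nonneg Fu
  have hV := maxRowNorm_nonneg Fv
  set Q : (Fin m × Fin n → Fin 2) → ℝ := fun x =>
    ∑ k, ∑ l, (∑ p, Fu p.1 k * Fv p.2 l * puNoise M ρ p (x p)) ^ 2 with hQ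
  have hQ0 : ∀ x, 0 ≤ Q x := fun x =>
    Finset.sum_nonneg fun k _ => Finset.sum_nonneg fun l _ => sq_nonneg _
  have hlin : ∑ x : Fin m × Fin n → Fin 2, (∏ p, puWeight M ρ p (x p)) *
      ∑ p, M p.1 p.2 * puNoise M ρ p (x p) = 0 := by
    simp only [Finset.mul_sum]
    rw [Finset.sum_comm]
    refine Finset.sum_eq_zero fun p _ => ?_
    simp only [mul_left_comm _ (M p.1 p.2)]
    rw [← Finset.mul_sum, sum_prod_mul_apply_eq_zero (puWeight M ρ) (puNoise M ρ)
      (sum_puWeight_mul_puNoise hρ1), mul_zero]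
  have hsecond : ∑ x : Fin m × Fin n → Fin 2, (∏ p, puWeight M ρ p (x p)) * Q x ≤
      (m : ℝ) * n / (1 - ρ) * (maxRowNorm Fu * maxRowNorm Fv) ^ 2 := by
    calc ∑ x : Fin m × Fin n → Fin 2, (∏ p, puWeight M ρ p (x p)) * Q x
        = ∑ k, ∑ l, ∑ x : Fin m × Fin n → Fin 2, (∏ p, puWeight M ρ p (x p)) *
            (∑ p, Fu p.1 k * Fv p.2 l * puNoise M ρ p (x p)) ^ 2 := by
          simp only [hQ, Finset.mul_sum]
          rw [Finset.sum_comm]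
          exact Finset.sum_congr rfl fun k _ => Finset.sum_comm
      _ ≤ ∑ k, ∑ l, ∑ p : Fin m × Fin n, (Fu p.1 k * Fv p.2 l) ^ 2 * (1 / (1 - ρ)) := by
          refine Finset.sum_le_sum fun k _ => Finset.sum_le_sum fun l _ => ?_
          -- Independence kills the cross terms, leaving only entry variances.
          rw [sum_prod_mul_sum_sq (puWeight M ρ) (puNoise M ρ) sum_puWeight
            (sum_puWeight_mul_puNoise hρ1) fun p => Fu p.1 k * Fv p.2 l]
          exact Finset.sum_le_sum fun p _ => mul_le_mul_of_nonneg_left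
            (sum_puWeight_mul_puNoise_sq_le hM01 hρ1 p) (sq_nonneg _)
      _ = ∑ p : Fin m × Fin n, (∑ k, Fu p.1 k ^ 2) * (∑ l, Fv p.2 l ^ 2) * (1 / (1 - ρ)) := by
          rw [Finset.sum_congr rfl fun k _ => Finset.sum_comm, Finset.sum_comm]
          refine Finset.sum_congr rfl fun p _ => ?_
          simp only [mul_pow, Finset.sum_mul_sum]
          simp only [Finset.sum_mul]
      _ ≤ ∑ _p : Fin m × Fin n, maxRowNorm Fu ^ 2 * maxRowNorm Fv ^ 2 * (1 / (1 - ρ)) := by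
          refine Finset.sum_le_sum fun p _ => mul_le_mul_of_nonneg_right ?_ (by positivity)
          exact mul_le_mul (sum_sq_row_le_maxRowNorm_sq _ _) (sum_sq_row_le_maxRowNorm_sq _ _)
            (Finset.sum_nonneg fun k _ => sq_nonneg _) (sq_nonneg _)
      _ = _ := by
          simp
          ring
  have hmean : ∑ x : Fin m × Fin n → Fin 2, (∏ p, puWeight M ρ p (x p)) * √(Q x) ≤
      √((m : ℝ) * n) / √(1 - ρ) * (maxRowNorm Fu * maxRowNorm Fv) := by
    refine (sum_mul_sqrt_le _ Q hW hW1 hQ0).trans ((Real.sqrt_le_sqrt hsecond).trans_eq ?_)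
    rw [Real.sqrt_mul (by positivity), Real.sqrt_sq (by positivity), Real.sqrt_div (by positivity)]
  calc ∑ x : Fin m × Fin n → Fin 2, (∏ p, puWeight M ρ p (x p)) * puSup Fu Fv M ρ t x
      ≤ ∑ x : Fin m × Fin n → Fin 2, (∏ p, puWeight M ρ p (x p)) *
          (2 * (t * √(Q x)) - 2 * ∑ p, M p.1 p.2 * puNoise M ρ p (x p)) :=
        Finset.sum_le_sum fun x _ => mul_le_mul_of_nonneg_left (puSup_le hne x) (hW x)
    _ = 2 * (t * ∑ x : Fin m × Fin n → Fin 2, (∏ p, puWeight M ρ p (x p)) * √(Q x)) -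
          2 * ∑ x : Fin m × Fin n → Fin 2, (∏ p, puWeight M ρ p (x p)) *
            ∑ p, M p.1 p.2 * puNoise M ρ p (x p) := by
        rw [Finset.mul_sum, Finset.mul_sum, Finset.mul_sum, ← Finset.sum_sub_distrib]
        exact Finset.sum_congr rfl fun x _ => by ring
    _ ≤ _ := by
        rw [hlin, mul_zero, sub_zero]
        gcongr

/-- The optimality inequality: the squared error of a minimizer is at most the supremum of the
noise process. -/
theorem sum_sq_error_le_puSup (hM01 : ∀ i j, 0 ≤ M i j ∧ M i j ≤ 1) (hρ1 : ρ < 1)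
    {D₀ : Matrix (Fin d) (Fin d) ℝ} (hD₀ : D₀ ∈ inductiveFeasible Fu Fv t)
    (hMD₀ : Fu * D₀ * Fvᵀ = M) {B : Matrix (Fin m) (Fin n) (Fin 2)}
    {D : Matrix (Fin d) (Fin d) ℝ} (hD : IsInductiveShiftMC Fu Fv ρ t B D) :
    ∑ i, ∑ j, (M i j - (Fu * D * Fvᵀ) i j) ^ 2 ≤
      puSup Fu Fv M ρ t fun p => B p.1 p.2 := by
  refine le_trans ?_ (le_puSup hM01 hD.1 _)
  have h := isMinOn_iff.1 hD.2 D₀ hD₀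
  simp only [hMD₀] at h
  rw [← Fintype.sum_prod_type (f := fun p : Fin m × Fin n =>
      shiftLoss ρ ((Fu * D * Fvᵀ) p.1 p.2) (B p.1 p.2)),
    ← Fintype.sum_prod_type (f := fun p : Fin m × Fin n =>
      shiftLoss ρ (M p.1 p.2) (B p.1 p.2))] at h
  rw [← Fintype.sum_prod_type (f := fun p : Fin m × Fin n =>
    (M p.1 p.2 - (Fu * D * Fvᵀ) p.1 p.2) ^ 2)]
  -- An exact identity; summed over entries, the loss differences are nonpositive by optimality of
  -- `D`.
  have e : ∀ p : Fin m × Fin n, (M p.1 p.2 - (Fu * D * Fvᵀ) p.1 p.2) ^ 2 =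
      2 * (((Fu * D * Fvᵀ) p.1 p.2 - M p.1 p.2) * puNoise M ρ p (B p.1 p.2)) +
      (shiftLoss ρ ((Fu * D * Fvᵀ) p.1 p.2) (B p.1 p.2) -
        shiftLoss ρ (M p.1 p.2) (B p.1 p.2)) := by
    intro p
    rw [shiftLoss_eq (M := M) hρ1 _ p, shiftLoss_eq (M := M) hρ1 _ p]
    ring
  rw [Finset.sum_congr rfl fun p _ => e p, Finset.sum_add_distrib, Finset.sum_sub_distrib,
    Finset.mul_sum]
  linarith

end NoiseSup

/-! ### From the probability space to the finite product weight. -/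

theorem IsPUObservation.measure_eq_prod {m n : ℕ} {Ω : Type*} [MeasurableSpace Ω] {P : Measure Ω}
    {M : Matrix (Fin m) (Fin n) ℝ} {ρ : ℝ} {A : Ω → Matrix (Fin m) (Fin n) (Fin 2)}
    (hA : IsPUObservation P M ρ A) (hw : ∀ p a, 0 ≤ puWeight M ρ p a)
    (x : Fin m × Fin n → Fin 2) :
    P {ω | (fun p : Fin m × Fin n => A ω p.1 p.2) = x} =
      ENNReal.ofReal (∏ p, puWeight M ρ p (x p)) := by
  have h := hA.indep.measure_inter_preimage_eq_mul Finset.univ (sets := fun p => {x p})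
    fun p _ => MeasurableSet.singleton _
  have e : {ω | (fun p : Fin m × Fin n => A ω p.1 p.2) = x} =
      ⋂ p ∈ (Finset.univ : Finset (Fin m × Fin n)),
        (fun ω => A ω p.1 p.2) ⁻¹' {x p} := by
    ext ω
    simp [funext_iff]
  rw [e, h, ENNReal.ofReal_prod_of_nonneg fun p _ => hw _ _]
  refine Finset.prod_congr rfl fun p _ => ?_
  unfold puWeight
  split_ifs with hx
  · rw [← hA.prob_one, hx]
    rfl
  · have hx' : x p = 0 := by omega
    rw [← hA.prob_zero, hx']
    rfl

theorem IsPUObservation.measure_mem_le {m n : ℕ} {Ω : Type*} [MeasurableSpace Ω] {P : Measure Ω}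
    {M : Matrix (Fin m) (Fin n) ℝ} {ρ : ℝ} {A : Ω → Matrix (Fin m) (Fin n) (Fin 2)}
    (hA : IsPUObservation P M ρ A) (hw : ∀ p a, 0 ≤ puWeight M ρ p a)
    (S : Finset (Fin m × Fin n → Fin 2)) :
    P {ω | (fun p : Fin m × Fin n => A ω p.1 p.2) ∈ S} ≤
      ENNReal.ofReal (∑ x ∈ S, ∏ p, puWeight M ρ p (x p)) := by
  have e : {ω | (fun p : Fin m × Fin n => A ω p.1 p.2) ∈ S} =
      ⋃ x ∈ S, {ω | (fun p : Fin m × Fin n => A ω p.1 p.2) = x} := by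
    ext ω
    simp
  rw [e, ENNReal.ofReal_sum_of_nonneg fun x _ => Finset.prod_nonneg fun p _ => hw _ _]
  exact (measure_biUnion_finset_le _ _).trans_eq
    (Finset.sum_congr rfl fun x _ => hA.measure_eq_prod hw x)

/-! ### The error bound. -/

theorem mainTheorem4 {m n d : ℕ} (hm : 0 < m) (hn : 0 < n) (hd : 0 < d)
    (Fu : Matrix (Fin m) (Fin d) ℝ) (Fv : Matrix (Fin n) (Fin d) ℝ)
    (M : Matrix (Fin m) (Fin n) ℝ) (hM01 : ∀ i j, 0 ≤ M i j ∧ M i j ≤ 1)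
    (t : ℝ) (hMt : nuclearNorm M ≤ t)
    (hMF : M = Fu * Fuᵀ * M * (Fv * Fvᵀ))
    (ρ : ℝ) (hρ0 : 0 ≤ ρ) (hρ1 : ρ < 1)
    {Ω : Type*} [MeasurableSpace Ω] (P : Measure Ω) [IsProbabilityMeasure P]
    (A : Ω → Matrix (Fin m) (Fin n) (Fin 2)) (hA : IsPUObservation P M ρ A)
    (δ : ℝ) (hδ0 : 0 < δ) (hδ1 : δ < 1) :
    ENNReal.ofReal (1 - δ) ≤
      P {ω | ∀ D : Matrix (Fin d) (Fin d) ℝ, IsInductiveShiftMC Fu Fv ρ t (A ω) D →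
        1 / ((m : ℝ) * n) * ∑ i, ∑ j, (M i j - (Fu * D * Fvᵀ) i j) ^ 2 ≤
          6 * (√(Real.log (2 / δ)) / (√((m : ℝ) * n) * (1 - ρ))) +
          4 * t * √(Real.log (2 * d)) / (√((m : ℝ) * n) * √(1 - ρ)) *
            (maxRowNorm Fu * maxRowNorm Fv)} := by
  classical
  have hq : 0 < 1 - ρ := by linarith
  have ht : 0 ≤ t := (nuclearNorm_nonneg M).trans hMt
  have hU := maxRowNorm_nonneg Fu
  have hV := maxRowNorm_nonneg Fv
  have hmn : (0 : ℝ) < (m : ℝ) * n := by positivity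
  have hw := puWeight_nonneg hM01 hρ0 hρ1
  have hMD₀ : Fu * (Fuᵀ * M * Fv) * Fvᵀ = M := by
    conv_rhs => rw [hMF]
    simp only [Matrix.mul_assoc]
  have hD₀ : Fuᵀ * M * Fv ∈ inductiveFeasible Fu Fv t :=
    ⟨(nuclearNorm_features Fu Fv M hMF).trans_le hMt, fun i j => by rw [hMD₀]; exact hM01 i j⟩
  set μ := ∑ x : Fin m × Fin n → Fin 2, (∏ p, puWeight M ρ p (x p)) * puSup Fu Fv M ρ t x with hμ
  have hμle := mean_puSup_le hM01 hρ0 hρ1 ht ⟨_, hD₀⟩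
  rw [← hμ] at hμle
  set L := Real.log (2 / δ) with hL
  have hL0 : 0 < L := Real.log_pos (by rw [lt_div_iff₀ hδ0]; linarith)
  -- `m * n` times the first term of the bound. With differences `2 / (1 - ρ)` the McDiarmid
  -- exponent is `36 / 8 * L`, more than the `L` needed for a tail of `δ / 2`.
  set s := 6 * (√L * √((m : ℝ) * n) / (1 - ρ)) with hs
  have hs0 : 0 ≤ s := by positivity
  let S : Finset (Fin m × Fin n → Fin 2) :=
    Finset.univ.filter fun x => s ≤ puSup Fu Fv M ρ t x - μ
  have htail : ∑ x ∈ S, ∏ p, puWeight M ρ p (x p) ≤ δ := by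
    have h := sum_prod_le_exp_of_le_sub_mean (puWeight M ρ) hw sum_puWeight
      (puSup Fu Fv M ρ t) (2 / (1 - ρ)) (by positivity) (puSup_sub_update_le hM01 hρ1 ⟨_, hD₀⟩)
      (by simp [hm, hn]) s hs0 S fun x hx => (Finset.mem_filter.1 hx).2
    refine h.trans ?_
    have hcard : (Fintype.card (Fin m × Fin n) : ℝ) = (m : ℝ) * n := by simp
    have e : s ^ 2 / (2 * (Fintype.card (Fin m × Fin n) : ℝ) * (2 / (1 - ρ)) ^ 2) =
        9 / 2 * L := by
      rw [hcard, hs, mul_pow, div_pow, mul_pow, Real.sq_sqrt hL0.le, Real.sq_sqrt hmn.le]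
      field_simp
      norm_num
    rw [e]
    calc Real.exp (-(9 / 2 * L)) ≤ Real.exp (-L) := Real.exp_le_exp.2 (by linarith)
      _ = δ / 2 := by
        rw [hL, Real.exp_neg, Real.exp_log (by positivity), inv_div]
      _ ≤ δ := by linarith
  have hSmeas : MeasurableSet {ω | (fun p : Fin m × Fin n => A ω p.1 p.2) ∈ S} :=
    (measurable_pi_lambda _ fun p : Fin m × Fin n => hA.measurable_entry p.1 p.2)
      S.measurableSet
  have hgood : ENNReal.ofReal (1 - δ) ≤
      P {ω | (fun p : Fin m × Fin n => A ω p.1 p.2) ∈ S}ᶜ := by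
    rw [prob_compl_eq_one_sub hSmeas, ENNReal.ofReal_sub _ hδ0.le, ENNReal.ofReal_one]
    exact tsub_le_tsub_left
      ((hA.measure_mem_le hw S).trans (ENNReal.ofReal_le_ofReal htail)) _
  -- Every outcome outside `S` satisfies the bound for all minimizers at once, so the target event
  -- need not be shown measurable.
  refine hgood.trans (measure_mono fun ω hω D hD => ?_)
  have h1 := sum_sq_error_le_puSup hM01 hρ1 hD₀ hMD₀ hD
  have h2 : puSup Fu Fv M ρ t (fun p => A ω p.1 p.2) - μ < s := by
    by_contra! hcon
    exact hω (Finset.mem_filter.2 ⟨Finset.mem_univ _, hcon⟩)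
  -- The mean bound has constant 2 and no logarithm; since `log 2 ≥ 1 / 4`, the stated `4 * √(log (2
  -- * d))` dominates it.
  have hlog : 1 / 2 ≤ √(Real.log (2 * d)) := by
    apply Real.le_sqrt_of_sq_le
    have hd1 : (1 : ℝ) ≤ d := by exact_mod_cast hd
    have : Real.log 2 ≤ Real.log (2 * d) := Real.log_le_log two_pos (by linarith)
    linarith [Real.log_two_gt_d9]
  set R := √((m : ℝ) * n) with hR
  have hR0 : 0 < R := Real.sqrt_pos.2 hmn
  have hRR : (m : ℝ) * n = R * R := (Real.mul_self_sqrt hmn.le).symm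
  have hr0 : 0 < √(1 - ρ) := Real.sqrt_pos.2 hq
  calc 1 / ((m : ℝ) * n) * ∑ i, ∑ j, (M i j - (Fu * D * Fvᵀ) i j) ^ 2
      ≤ 1 / ((m : ℝ) * n) * (s + 2 * (t * (R / √(1 - ρ) * (maxRowNorm Fu * maxRowNorm Fv)))) :=
        mul_le_mul_of_nonneg_left (by linarith) (by positivity)
    _ = 6 * (√L / (R * (1 - ρ))) +
          4 * t * (1 / 2) / (R * √(1 - ρ)) * (maxRowNorm Fu * maxRowNorm Fv) := by
        rw [hRR, hs]
        field_simp
        ring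
    _ ≤ _ := by gcongr
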